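/- Let $M$ be a Hausdorff smooth manifold of dimension $n$, and let $\nabla$ be a linear connection on $M$ (a covariant derivative on $TM$, with arbitrary torsion) of class $C^k$, $1\le k\le\infty$. For a local basis $\{E_1,\dots,E_n\}$ of vector fields on an open set $U\subseteq M$ (holonomic or anholonomic, i.e. the $E_i$ need not commute), the components of $\nabla$ on $U$ are the functions $\Gamma^i_{jk}$ given by $\nabla_{E_k}E_j=\sum_i\Gamma^i_{jk}E_i$. The connection is flat on $U$ if $R(X,Y)Z=\nabla_X\nabla_YZ-\nabla_Y\nabla_XZ-\nabla_{[X,Y]}Z$ vanishes at every point of $U$ for all smooth vector fields $X,Y,Z$. Let $m$ satisfy $1\le m\le k+1$, and let $U\subseteq M$ be open. Then: 1. $\nabla$ is flat on $U$ if and only if every point of $U$ has an open neighborhood $V\subseteq U$ on which there is a local basis of class $C^m$ in which all components of $\nabla$ vanish on $V$. 2. If $U$ lies in the domain of a smooth chart that maps $U$ onto a convex subset of $\mathbb{R}^n$ (such $U$ form a base of neighborhoods of every point), then there is a local basis of class $C^m$ on $U$ in which all components of $\nabla$ vanish on $U$ if and only if $\nabla$ is flat on $U$. In particular, on any open $U$,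 if there is such a basis on $U$, then $\nabla$ is flat on $U$. -/

import Mathlib

open scoped Manifold ContDiff Bundle

/-- A linear connection on an `n`-dimensional manifold `M`: a covariant derivative on the tangent
bundle of `M`. For `D : LinearConnection n M` and vector fields `X`, `Z`, the vector
`(∇_X Z)(x)` is `D Z x (X x)`. No condition on the torsion is imposed. -/
abbrev LinearConnection (n : ℕ) (M : Type*) [TopologicalSpace M]
    [ChartedSpace (EuclideanSpace ℝ (Fin n)) M] [IsManifold (𝓡 n) ∞ M] :=
  CovariantDerivative (𝓡 n) (EuclideanSpace ℝ (Fin n)) (TangentSpace (𝓡 n) : M → Type _)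

namespace LinearConnection

variable {n : ℕ} {M : Type*} [TopologicalSpace M]
    [ChartedSpace (EuclideanSpace ℝ (Fin n)) M] [IsManifold (𝓡 n) ∞ M]

/-- The curvature operator `R(X, Y) Z = ∇_X ∇_Y Z - ∇_Y ∇_X Z - ∇_[X, Y] Z`, at the point `x`. -/
noncomputable def curvature (D : LinearConnection n M)
    (X Y Z : Π x : M, TangentSpace (𝓡 n) x) (x : M) : TangentSpace (𝓡 n) x :=
  D (fun y ↦ D Z y (Y y)) x (X x) - D (fun y ↦ D Z y (X y)) x (Y x)
    - D Z x (VectorField.mlieBracket (𝓡 n) X Y x)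

/-- The connection is flat (curvature free) on `U`: `R(X, Y) Z` vanishes at every point of `U`, for
all smooth vector fields `X`, `Y`, `Z`. -/
def IsFlatOn (D : LinearConnection n M) (U : Set M) : Prop :=
  ∀ X Y Z : Π x : M, TangentSpace (𝓡 n) x,
    ContMDiff (𝓡 n) (𝓡 n).tangent ∞ (fun x ↦ (X x : TangentBundle (𝓡 n) M)) →
    ContMDiff (𝓡 n) (𝓡 n).tangent ∞ (fun x ↦ (Y x : TangentBundle (𝓡 n) M)) →
    ContMDiff (𝓡 n) (𝓡 n).tangent ∞ (fun x ↦ (Z x : TangentBundle (𝓡 n) M)) →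
      ∀ x ∈ U, D.curvature X Y Z x = 0

/-- The components `Γ^i_{jk}` of the connection with respect to a local basis `{E_i}` of vector
fields on `U`, determined by `∇_{E_k} E_j = ∑ i, Γ^i_{jk} E_i` on `U`. -/
noncomputable def components (D : LinearConnection n M) {m : ℕ∞} {U : Set M}
    {B : Fin n → Π x : M, TangentSpace (𝓡 n) x}
    (hB : IsLocalFrameOn (𝓡 n) (EuclideanSpace ℝ (Fin n)) m B U) (i j k : Fin n) (x : M) : ℝ :=
  hB.coeff i x (D (B j) x (B k x))

/-- There is a local basis `{E_i}` of vector fields of class `C^m` on `U`, holonomic or not, in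
which all the components of the connection vanish on `U`. -/
def HasVanishingComponentsBasis (D : LinearConnection n M) (m : ℕ∞) (U : Set M) : Prop :=
  ∃ (B : Fin n → Π x : M, TangentSpace (𝓡 n) x)
    (hB : IsLocalFrameOn (𝓡 n) (EuclideanSpace ℝ (Fin n)) m B U),
      ∀ i j k : Fin n, ∀ x ∈ U, D.components hB i j k x = 0

end LinearConnection

/-- `U` is contained in the domain of a smooth chart of `M` that maps it onto a convex set. Open
sets of this kind form a base of neighbourhoods of every point of `M`. -/
def IsCoordinateConvex (n : ℕ) {M : Type*} [TopologicalSpace M]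
    [ChartedSpace (EuclideanSpace ℝ (Fin n)) M] (U : Set M) : Prop :=
  ∃ φ ∈ IsManifold.maximalAtlas (𝓡 n) ∞ M, U ⊆ φ.source ∧ Convex ℝ (φ '' U)

/-!
Let `Γ` be the Christoffel symbols of the connection in a chart `φ`, so that
`∇_v s = ds(v) + Γ(v) s` in coordinates (`LinearConnection.apply_chartField`). They are of class `C^k`
(`LinearConnection.contDiffOn_christoffel`), and the curvature operator becomes the tensor
`dΓ(u)(v) - dΓ(v)(u) + [Γ(u), Γ(v)]` (`LinearConnection.curvature_eq`). The components in a local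
basis vanish exactly when the basis consists of parallel vector fields, that is, of solutions of
`ds = -Γ s`.

If such a basis exists, differentiating `ds = -Γ s` once more and using the symmetry of second
derivatives shows that the curvature kills the values of the basis fields
(`IsParallelOn.connectionCurvature_eq_zero`), so it is zero.

Conversely, let the connection be flat and let the chart have convex image. Transport a vector from
a base point `p` along the segments from `p`, by solving a linear ODE on `[0, 1]`. That the section
obtained is differentiable and parallel follows directly from flatness and Grönwall's inequality
(`hasFDerivAt_radial_transport`): if `Y` is the transport along `c(t) = p + t (x - p)`, then
`Y - t Γ(c)(w) Y` solves the equation for the segment to `x + w` with an error whose first-order part in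
`w` is the curvature. The equation `ds = -Γ s` then makes `s` of class `C^(k+1)`, and a parallel
section vanishing at one point of a convex set vanishes identically, so a basis at `p` gives a
basis everywhere. For the local statement, every point has a neighbourhood that a chart maps onto a
ball.
-/

section

open scoped Manifold ContDiff Bundle
open Set Metric Filter Topology VectorField

-- Needed to find the norm on `E →L[ℝ] E →L[ℝ] F →L[ℝ] F`.
set_option maxSynthPendingDepth 3

section

/-! ### Linear differential equations and uniform Taylor expansions -/

variable {E F : Type*} [NormedAddCommGroup E] [NormedSpace ℝ E]
  [NormedAddCommGroup F] [NormedSpace ℝ F]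

theorem HasDerivWithinAt.Ici_of_Icc {f : ℝ → F} {f' : F} {a b t : ℝ}
    (h : HasDerivWithinAt f f' (Icc a b) t) (ht : t ∈ Ico a b) : HasDerivWithinAt f f' (Ici t) t :=
  h.mono_of_mem_nhdsWithin (Icc_mem_nhdsGE_of_mem ht)

/-- A linear ODE with continuous coefficients is solvable on all of `[0, 1]`. The Picard–Lindelöf
theorem asks for a bound on the field in terms of the radius of a ball, which a linear field fails
once its norm exceeds `1`; so the field is first cut off outside a large ball. -/
theorem exists_solution_linear_ODE [FiniteDimensional ℝ F] {A : ℝ → F →L[ℝ] F}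
    (hA : ContinuousOn A (Icc 0 1)) (y₀ : F) :
    ∃ y : ℝ → F, y 0 = y₀ ∧ ∀ t ∈ Icc (0 : ℝ) 1, HasDerivWithinAt y (A t (y t)) (Icc 0 1) t := by
  have : CompleteSpace F := FiniteDimensional.complete ℝ F
  obtain ⟨C, hC⟩ := isCompact_Icc.exists_bound_of_continuousOn hA
  have hC0 : 0 ≤ C := (norm_nonneg _).trans (hC 0 (by simp))
  -- larger than the Grönwall bound for the solution
  set R : ℝ := ‖y₀‖ * Real.exp C + 1 with hR
  have hRpos : 0 < R := by positivity
  let χ : ContDiffBump (0 : F) := ⟨R, R + 1, hRpos, by linarith⟩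
  let g : F → F := fun x ↦ χ x • x
  have hgsupp : HasCompactSupport g := χ.hasCompactSupport.smul_right
  have hgsmooth : ContDiff ℝ 1 g := χ.contDiff.smul contDiff_id
  obtain ⟨K, hK⟩ := hgsmooth.lipschitzWith_of_hasCompactSupport hgsupp one_ne_zero
  have hgle : ∀ x, ‖g x‖ ≤ ‖x‖ := fun x ↦ by
    simp only [g, norm_smul, Real.norm_eq_abs, abs_of_nonneg χ.nonneg]
    exact mul_le_of_le_one_left (norm_nonneg _) χ.le_one
  have hgR : ∀ x, ‖g x‖ ≤ R + 1 := fun x ↦ by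
    by_cases hx : ‖x‖ ≤ R + 1
    · exact (hgle x).trans hx
    · have : χ x = 0 := χ.zero_of_le_dist (by simpa [χ] using (not_le.1 hx).le)
      simp only [g, this, zero_smul, norm_zero]
      positivity
  let L : NNReal := ⟨C * (R + 1), by positivity⟩
  have hPL : IsPicardLindelof (fun t x ↦ A t (g x)) (tmin := 0) (tmax := 1)
      ⟨0, by simp⟩ y₀ L 0 L (⟨C, hC0⟩ * K) :=
    { lipschitzOnWith := fun t ht ↦ (((A t).lipschitzWith_of_opNorm_le
          (K := ⟨C, hC0⟩) (hC t ht)).comp hK).lipschitzOnWith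
      continuousOn := fun x _ ↦ hA.clm_apply continuousOn_const
      norm_le := fun t ht x _ ↦ ((A t).le_opNorm _).trans
        (mul_le_mul (hC t ht) (hgR x) (norm_nonneg _) hC0)
      mul_max_le := by simp }
  obtain ⟨y, hy0, hy⟩ := hPL.exists_eq_forall_mem_Icc_hasDerivWithinAt₀
  refine ⟨y, hy0, fun t ht ↦ ?_⟩
  -- Since `‖g x‖ ≤ ‖x‖`, Grönwall's inequality keeps the solution where `g x = x`.
  have hbound : ‖y t‖ ≤ R := by
    have h := norm_le_gronwallBound_of_norm_deriv_right_le (f := y) (δ := ‖y₀‖) (K := C) (ε := 0)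
      (fun s hs ↦ (hy s hs).continuousWithinAt)
      (fun s hs ↦ (hy s (Ico_subset_Icc_self hs)).Ici_of_Icc hs) (by rw [← hy0])
      (fun s hs ↦ by
        rw [add_zero]
        exact ((A s).le_opNorm _).trans (mul_le_mul (hC s (Ico_subset_Icc_self hs)) (hgle _)
          (norm_nonneg _) hC0)) t ht
    rw [gronwallBound_ε0, sub_zero] at h
    have : Real.exp (C * t) ≤ Real.exp C :=
      Real.exp_le_exp.2 (mul_le_of_le_one_right hC0 ht.2)
    nlinarith [norm_nonneg y₀]
  have h1 : g (y t) = y t := by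
    have : χ (y t) = 1 := χ.one_of_mem_closedBall (by simpa [χ] using hbound)
    simp [g, this]
  simpa [h1] using hy t ht

/-- Suppose `Y` moves with velocity `-G u Y` and `G` with velocity `G' u`, as happens for a
connection form `G` along a line with direction `u`. Then `-(G u Y) - (G w Y + t • ...)` is the
velocity of `Y - t • G w Y`, and the left-hand side is the error with which this vector solves the
transport equation for the form `Gt ≈ G + t • G' w` in the direction `u + w`. The part linear in `w`
is `t` times the curvature applied to `Y`, so flatness leaves only terms of second order. -/
theorem norm_parallel_residual_le {G Gt : E →L[ℝ] F →L[ℝ] F} {G' : E →L[ℝ] E →L[ℝ] F →L[ℝ] F}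
    {u w : E} {Y : F} {t B δ : ℝ} (hB : 1 ≤ B) (ht : t ∈ Icc (0 : ℝ) 1)
    (hG : ‖G‖ ≤ B) (hG' : ‖G'‖ ≤ B) (hu : ‖u‖ + 1 ≤ B) (hY : ‖Y‖ ≤ B)
    (hw : ‖w‖ ≤ δ) (hδ : δ ≤ 1)
    (hflat : G' u w Y - G' w u Y + G u (G w Y) - G w (G u Y) = 0)
    (hGt : ‖Gt - G - t • G' w‖ ≤ δ * ‖w‖) :
    ‖Gt (u + w) (Y - t • G w Y) + (-(G u Y) - (G w Y + t • (G' u w Y - G w (G u Y))))‖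
      ≤ 5 * B ^ 4 * δ * ‖w‖ := by
  have hδ0 : 0 ≤ δ := (norm_nonneg w).trans hw
  have hB0 : 0 ≤ B := by linarith
  have ht' : ‖t‖ ≤ 1 := by rw [Real.norm_eq_abs, abs_le]; constructor <;> linarith [ht.1, ht.2]
  set ρ := Gt - G - t • G' w with hρ
  have hGte : Gt = G + t • G' w + ρ := by rw [hρ]; abel
  have key : Gt (u + w) (Y - t • G w Y) + (-(G u Y) - (G w Y + t • (G' u w Y - G w (G u Y))))
      = t • G' w w Y - t • G w (G w Y) - t • G' w (u + w) (t • G w Y)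
        + ρ (u + w) (Y - t • G w Y) := by
    rw [hGte]
    simp only [add_apply, smul_apply, map_add, map_sub,
      map_smul]
    linear_combination (norm := module) (-t) • hflat
  have huw : ‖u + w‖ ≤ B := (norm_add_le _ _).trans (by linarith)
  have hGw : ‖G w Y‖ ≤ B * ‖w‖ * B :=
    (G.le_opNorm₂ w Y).trans (by gcongr)
  have hwB : B * ‖w‖ ≤ B := by nlinarith
  have e1 : ‖t • G' w w Y‖ ≤ B ^ 4 * δ * ‖w‖ := by
    calc ‖t • G' w w Y‖ ≤ ‖t‖ * (‖G' w w‖ * ‖Y‖) := by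
          rw [norm_smul]; gcongr; exact (G' w w).le_opNorm _
      _ ≤ 1 * ((B * ‖w‖ * ‖w‖) * B) := by
          gcongr
          exact (G'.le_opNorm₂ w w).trans (by gcongr)
      _ = B ^ 2 * ‖w‖ * ‖w‖ := by ring
      _ ≤ B ^ 4 * δ * ‖w‖ := by
          gcongr
          · norm_num
  have e2 : ‖t • G w (G w Y)‖ ≤ B ^ 4 * δ * ‖w‖ := by
    calc ‖t • G w (G w Y)‖ ≤ ‖t‖ * (‖G‖ * ‖w‖ * ‖G w Y‖) := by
          rw [norm_smul]; gcongr; exact G.le_opNorm₂ _ _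
      _ ≤ 1 * (B * ‖w‖ * (B * ‖w‖ * B)) := by gcongr
      _ = B ^ 3 * ‖w‖ * ‖w‖ := by ring
      _ ≤ B ^ 4 * δ * ‖w‖ := by
          gcongr
          · norm_num
  have e3 : ‖t • G' w (u + w) (t • G w Y)‖ ≤ B ^ 4 * δ * ‖w‖ := by
    calc ‖t • G' w (u + w) (t • G w Y)‖ ≤ ‖t‖ * (‖G' w (u + w)‖ * (‖t‖ * ‖G w Y‖)) := by
          rw [norm_smul]; gcongr
          exact ((G' w (u + w)).le_opNorm _).trans (by rw [norm_smul])
      _ ≤ 1 * ((B * δ * B) * (1 * (B * ‖w‖ * B))) := by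
          gcongr
          exact (G'.le_opNorm₂ w (u + w)).trans (by gcongr)
      _ = B ^ 4 * δ * ‖w‖ := by ring
  have e4 : ‖ρ (u + w) (Y - t • G w Y)‖ ≤ 2 * B ^ 4 * δ * ‖w‖ := by
    have hZ : ‖Y - t • G w Y‖ ≤ 2 * B ^ 2 := by
      calc ‖Y - t • G w Y‖ ≤ ‖Y‖ + ‖t‖ * ‖G w Y‖ := by rw [← norm_smul]; exact norm_sub_le _ _
        _ ≤ B + 1 * (B * ‖w‖ * B) := by gcongr
        _ ≤ 2 * B ^ 2 := by nlinarith
    calc ‖ρ (u + w) (Y - t • G w Y)‖ ≤ ‖ρ‖ * ‖u + w‖ * ‖Y - t • G w Y‖ := ρ.le_opNorm₂ _ _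
      _ ≤ (δ * ‖w‖) * B * (2 * B ^ 2) := by gcongr
      _ = 2 * B ^ 3 * δ * ‖w‖ := by ring
      _ ≤ 2 * B ^ 4 * δ * ‖w‖ := by
          gcongr
          · norm_num
  rw [key]
  calc _ ≤ ‖t • G' w w Y‖ + ‖t • G w (G w Y)‖ + ‖t • G' w (u + w) (t • G w Y)‖
        + ‖ρ (u + w) (Y - t • G w Y)‖ :=
        (norm_add_le _ _).trans (add_le_add_left ((norm_sub_le _ _).trans
          (add_le_add_left (norm_sub_le _ _) _)) _)
    _ ≤ 5 * B ^ 4 * δ * ‖w‖ := by linarith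

/-- The first-order Taylor expansion of a `C¹` map has an error which is uniform along a compact
curve. -/
theorem eventually_forall_taylor_segment {G : Type*} [NormedAddCommGroup G] [NormedSpace ℝ G]
    {Γ : E → G} {Ω : Set E} (hΩ : IsOpen Ω) (hΓ : ContDiffOn ℝ 1 Γ Ω) {c : ℝ → E}
    (hc : ContinuousOn c (Icc 0 1)) (hcΩ : ∀ t ∈ Icc (0 : ℝ) 1, c t ∈ Ω) {δ : ℝ} (hδ : 0 < δ) :
    ∀ᶠ w in 𝓝 (0 : E), ∀ t ∈ Icc (0 : ℝ) 1,
      ‖Γ (c t + t • w) - Γ (c t) - t • fderiv ℝ Γ (c t) w‖ ≤ δ * ‖w‖ := by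
  have hK : IsCompact (c '' Icc 0 1) := isCompact_Icc.image_of_continuousOn hc
  have hfd : ContinuousOn (fderiv ℝ Γ) Ω := hΓ.continuousOn_fderiv_of_isOpen hΩ le_rfl
  have h1 : ∀ᶠ h in 𝓝 (0 : E), ∀ x ∈ c '' Icc 0 1,
      x + h ∈ Ω ∧ ‖fderiv ℝ Γ (x + h) - fderiv ℝ Γ x‖ < δ := by
    refine hK.eventually_forall_of_forall_eventually fun x hx ↦ ?_
    have hxΩ : x ∈ Ω := by obtain ⟨t, ht, rfl⟩ := hx; exact hcΩ t ht
    have hcont : ContinuousAt (fderiv ℝ Γ) x := hfd.continuousAt (hΩ.mem_nhds hxΩ)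
    have hadd : Tendsto (fun z : E × E ↦ z.2 + z.1) (𝓝 (0, x)) (𝓝 x) := by
      have : Continuous fun z : E × E ↦ z.2 + z.1 := by fun_prop
      simpa using this.tendsto (0, x)
    have hsnd : Tendsto (fun z : E × E ↦ z.2) (𝓝 (0, x)) (𝓝 x) := continuous_snd.tendsto (0, x)
    have hd : Tendsto (fun z : E × E ↦ ‖fderiv ℝ Γ (z.2 + z.1) - fderiv ℝ Γ z.2‖)
        (𝓝 (0, x)) (𝓝 0) := by
      simpa using ((hcont.tendsto.comp hadd).sub (hcont.tendsto.comp hsnd)).norm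
    exact (hadd.eventually (hΩ.mem_nhds hxΩ)).and (hd.eventually (gt_mem_nhds hδ))
  obtain ⟨r, hr, hball⟩ := Metric.eventually_nhds_iff_ball.1 h1
  filter_upwards [ball_mem_nhds (0 : E) hr] with w hw t ht
  have hmem : ∀ z ∈ ball (c t) r, z ∈ Ω ∧ ‖fderiv ℝ Γ z - fderiv ℝ Γ (c t)‖ < δ := fun z hz ↦ by
    simpa using hball (z - c t) (by simpa [dist_eq_norm] using hz) (c t) (mem_image_of_mem c ht)
  have htw : ‖t • w‖ ≤ ‖w‖ := by
    rw [norm_smul, Real.norm_eq_abs, abs_of_nonneg ht.1]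
    exact mul_le_of_le_one_left (norm_nonneg _) ht.2
  have := (convex_ball (c t) r).norm_image_sub_le_of_norm_fderiv_le' (𝕜 := ℝ) (f := Γ) (C := δ)
    (φ := fderiv ℝ Γ (c t)) (x := c t) (y := c t + t • w)
    (fun z hz ↦ (hΓ.differentiableOn one_ne_zero).differentiableAt (hΩ.mem_nhds (hmem z hz).1))
    (fun z hz ↦ (hmem z hz).2.le) (mem_ball_self hr)
    (by simpa using htw.trans_lt (by simpa using hw))
  simp only [add_sub_cancel_left, map_smul] at this
  exact this.trans (by gcongr)

/-! ### Parallel sections of connections on trivial bundles -/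

/-- The curvature at `x` of the connection `∇_u s = ds(u) + Γ(u) s` on the trivial bundle with
fibre `F`, evaluated on the constant vector fields `u` and `v`, as an endomorphism of `F`. -/
noncomputable def connectionCurvature (Γ : E → E →L[ℝ] F →L[ℝ] F) (x u v : E) : F →L[ℝ] F :=
  fderiv ℝ Γ x u v - fderiv ℝ Γ x v u + Γ x u ∘L Γ x v - Γ x v ∘L Γ x u

theorem connectionCurvature_apply (Γ : E → E →L[ℝ] F →L[ℝ] F) (x u v : E) (w : F) :
    connectionCurvature Γ x u v w =
      fderiv ℝ Γ x u v w - fderiv ℝ Γ x v u w + Γ x u (Γ x v w) - Γ x v (Γ x u w) := rfl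

/-- The section `s` is parallel on `Ω` for the connection `∇_u s = ds(u) + Γ(u) s`. -/
def IsParallelOn (Γ : E → E →L[ℝ] F →L[ℝ] F) (s : E → F) (Ω : Set E) : Prop :=
  ∀ x ∈ Ω, HasFDerivAt s (-(Γ x).flip (s x)) x

theorem gronwallBound_zero_one_le {K ε : ℝ} (hK : 1 ≤ K) (hε : 0 ≤ ε) :
    gronwallBound 0 K ε 1 ≤ ε * Real.exp K := by
  rw [gronwallBound_of_K_ne_0 (by positivity)]
  have h1 : ε / K ≤ ε := div_le_self hε hK
  have h2 : 0 ≤ Real.exp (K * 1) - 1 := by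
    have := Real.add_one_le_exp (K * 1)
    linarith
  calc 0 * Real.exp (K * 1) + ε / K * (Real.exp (K * 1) - 1)
      ≤ ε * (Real.exp (K * 1) - 1) := by rw [zero_mul, zero_add]; gcongr
    _ ≤ ε * Real.exp K := by rw [mul_one]; gcongr; linarith

/-- Let `Y x` be the parallel transport of `w₀` along the segment from `p` to `x`. For a flat
connection, `x ↦ Y x 1` is differentiable and parallel. No differentiable dependence of ODE
solutions on parameters is needed: by flatness `Y x t - t • Γ (c t) w (Y x t)` solves the transport equation
towards `x + w` up to `o(w)`, and Grönwall's inequality compares it with `Y (x + w) t`. -/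
theorem hasFDerivAt_radial_transport {Γ : E → E →L[ℝ] F →L[ℝ] F} {Ω : Set E} (hΩ : IsOpen Ω)
    (hconv : Convex ℝ Ω) (hΓ : ContDiffOn ℝ 1 Γ Ω)
    (hflat : ∀ x ∈ Ω, ∀ u v, connectionCurvature Γ x u v = 0) {p : E} (hp : p ∈ Ω) {w₀ : F}
    {Y : E → ℝ → F} (hY0 : ∀ x ∈ Ω, Y x 0 = w₀)
    (hY : ∀ x ∈ Ω, ∀ t ∈ Icc (0 : ℝ) 1,
      HasDerivWithinAt (Y x) (-Γ (p + t • (x - p)) (x - p) (Y x t)) (Icc 0 1) t)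
    {x : E} (hx : x ∈ Ω) : HasFDerivAt (fun z ↦ Y z 1) (-(Γ x).flip (Y x 1)) x := by
  set u := x - p with hu
  set c : ℝ → E := fun t ↦ p + t • u with hc
  have hmem : ∀ z ∈ Ω, ∀ t ∈ Icc (0 : ℝ) 1, p + t • (z - p) ∈ Ω := fun z hz t ht ↦
    hconv.add_smul_sub_mem hp hz ht
  have hcΩ : ∀ t ∈ Icc (0 : ℝ) 1, c t ∈ Ω := hmem x hx
  have hccont : Continuous c := by fun_prop
  have hΓc : ContinuousOn (fun t ↦ Γ (c t)) (Icc 0 1) :=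
    hΓ.continuousOn.comp hccont.continuousOn hcΩ
  have hDc : ContinuousOn (fun t ↦ fderiv ℝ Γ (c t)) (Icc 0 1) :=
    (hΓ.continuousOn_fderiv_of_isOpen hΩ le_rfl).comp hccont.continuousOn hcΩ
  have hYc : ContinuousOn (Y x) (Icc 0 1) := fun t ht ↦ (hY x hx t ht).continuousWithinAt
  obtain ⟨B₁, hB₁⟩ := isCompact_Icc.exists_bound_of_continuousOn hΓc
  obtain ⟨B₂, hB₂⟩ := isCompact_Icc.exists_bound_of_continuousOn hDc
  obtain ⟨B₃, hB₃⟩ := isCompact_Icc.exists_bound_of_continuousOn hYc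
  obtain ⟨B, hB⟩ : ∃ B, B = max (‖u‖ + 1) (max B₁ (max B₂ B₃)) := ⟨_, rfl⟩
  have hBu : ‖u‖ + 1 ≤ B := hB ▸ le_max_left _ _
  have hBΓ : ∀ t ∈ Icc (0 : ℝ) 1, ‖Γ (c t)‖ ≤ B := fun t ht ↦ (hB₁ t ht).trans (by simp [hB])
  have hBD : ∀ t ∈ Icc (0 : ℝ) 1, ‖fderiv ℝ Γ (c t)‖ ≤ B := fun t ht ↦
    (hB₂ t ht).trans (by simp [hB])
  have hBY : ∀ t ∈ Icc (0 : ℝ) 1, ‖Y x t‖ ≤ B := fun t ht ↦ (hB₃ t ht).trans (by simp [hB])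
  have hB1 : 1 ≤ B := by linarith [norm_nonneg u]
  have hB0 : 0 ≤ B := by linarith
  obtain ⟨K, hK⟩ : ∃ K, K = (2 * B + 1) * B := ⟨_, rfl⟩
  have hK1 : 1 ≤ K := by rw [hK]; nlinarith
  rw [hasFDerivAt_iff_isLittleO_nhds_zero, Asymptotics.isLittleO_iff]
  intro ε hε
  obtain ⟨δ, hδ0, hδ1, hδε⟩ : ∃ δ : ℝ, 0 < δ ∧ δ ≤ 1 ∧ 5 * B ^ 4 * δ * Real.exp K ≤ ε := by
    have hM : 0 < 5 * B ^ 4 * Real.exp K := by positivity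
    refine ⟨min 1 (ε / (5 * B ^ 4 * Real.exp K)), by positivity, min_le_left _ _, ?_⟩
    calc 5 * B ^ 4 * min 1 (ε / (5 * B ^ 4 * Real.exp K)) * Real.exp K
        = (5 * B ^ 4 * Real.exp K) * min 1 (ε / (5 * B ^ 4 * Real.exp K)) := by ring
      _ ≤ (5 * B ^ 4 * Real.exp K) * (ε / (5 * B ^ 4 * Real.exp K)) := by
          gcongr; exact min_le_right _ _
      _ = ε := by field_simp
  have hxΩ : ∀ᶠ w in 𝓝 (0 : E), x + w ∈ Ω := by
    have : Tendsto (fun w ↦ x + w) (𝓝 0) (𝓝 x) := by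
      have h : Continuous fun w : E ↦ x + w := by fun_prop
      simpa using h.tendsto 0
    exact this.eventually (hΩ.mem_nhds hx)
  filter_upwards [hxΩ, eventually_forall_taylor_segment hΩ hΓ hccont.continuousOn hcΩ hδ0,
    closedBall_mem_nhds (0 : E) hδ0] with w hwΩ htaylor hwδ
  rw [mem_closedBall_zero_iff] at hwδ
  have hcw : ∀ t : ℝ, p + t • (x + w - p) = c t + t • w := fun t ↦ by
    simp only [hc, hu]; module
  have hY' : ∀ t ∈ Icc (0 : ℝ) 1, HasDerivWithinAt (Y (x + w))
      (-Γ (c t + t • w) (u + w) (Y (x + w) t)) (Icc 0 1) t := fun t ht ↦ by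
    have h := hY (x + w) hwΩ t ht
    rw [hcw] at h
    rwa [show u + w = x + w - p by rw [hu]; abel]
  -- the first-order prediction for the transport to `x + w`
  let Z : ℝ → F := fun t ↦ Y x t - t • Γ (c t) w (Y x t)
  have hZ : ∀ t ∈ Icc (0 : ℝ) 1, HasDerivWithinAt Z
      (-(Γ (c t) u (Y x t)) - (Γ (c t) w (Y x t) + t • (fderiv ℝ Γ (c t) u w (Y x t)
        - Γ (c t) w (Γ (c t) u (Y x t))))) (Icc 0 1) t := fun t ht ↦ by
    have hct : HasDerivAt c u t :=
      (((hasDerivAt_id t).smul_const u).const_add p).congr_deriv (one_smul _ _)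
    have hΓt : HasDerivAt (fun t ↦ Γ (c t)) (fderiv ℝ Γ (c t) u) t :=
      ((hΓ.differentiableOn one_ne_zero).differentiableAt
        (hΩ.mem_nhds (hcΩ t ht))).hasFDerivAt.comp_hasDerivAt t hct
    have h1 : HasDerivAt (fun t ↦ Γ (c t) w) (fderiv ℝ Γ (c t) u w) t := by
      simpa using hΓt.clm_apply (hasDerivAt_const t w)
    have h2 := h1.hasDerivWithinAt.clm_apply (hY x hx t ht)
    have h3 := (hY x hx t ht).sub ((hasDerivWithinAt_id t _).smul h2)
    refine h3.congr_deriv ?_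
    simp only [id, map_neg, one_smul, ← hu]
    module
  let e : ℝ → F := fun t ↦ Y (x + w) t - Z t
  have he : ∀ t ∈ Icc (0 : ℝ) 1, HasDerivWithinAt e _ (Icc 0 1) t := fun t ht ↦
    (hY' t ht).sub (hZ t ht)
  have hbound := norm_le_gronwallBound_of_norm_deriv_right_le (f := e) (δ := 0) (K := K)
    (ε := 5 * B ^ 4 * δ * ‖w‖) (fun t ht ↦ (he t ht).continuousWithinAt)
    (fun t ht ↦ (he t (Ico_subset_Icc_self ht)).Ici_of_Icc ht)
    (by simp [e, Z, hY0 x hx, hY0 _ hwΩ])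
    (fun t ht' ↦ by
      have ht := Ico_subset_Icc_self ht'
      have hres := norm_parallel_residual_le (u := u) hB1 ht (hBΓ t ht) (hBD t ht) hBu (hBY t ht)
        hwδ hδ1 (DFunLike.congr_fun (hflat _ (hcΩ t ht) u w) (Y x t)) (htaylor t ht)
      have hop : ‖Γ (c t + t • w) (u + w)‖ ≤ K := by
        have h1 : ‖Γ (c t + t • w)‖ ≤ 2 * B + 1 := by
          have ht1 : ‖t‖ ≤ 1 := by rw [Real.norm_eq_abs, abs_of_nonneg ht.1]; exact ht.2
          have h2 : ‖t • fderiv ℝ Γ (c t) w‖ ≤ B := by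
            calc ‖t • fderiv ℝ Γ (c t) w‖ ≤ ‖t‖ * (‖fderiv ℝ Γ (c t)‖ * ‖w‖) := by
                  rw [norm_smul]; gcongr; exact ContinuousLinearMap.le_opNorm _ _
              _ ≤ 1 * (B * 1) := by gcongr; exacts [hBD t ht, hwδ.trans hδ1]
              _ = B := by ring
          have h3 : δ * ‖w‖ ≤ 1 := mul_le_one₀ hδ1 (norm_nonneg _) (hwδ.trans hδ1)
          have h4 : Γ (c t + t • w) = Γ (c t) + t • fderiv ℝ Γ (c t) w
              + (Γ (c t + t • w) - Γ (c t) - t • fderiv ℝ Γ (c t) w) := by abel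
          rw [h4]
          refine (norm_add₃_le).trans ?_
          linarith [hBΓ t ht, htaylor t ht]
        refine (ContinuousLinearMap.le_opNorm _ _).trans ?_
        rw [hK]
        gcongr
        exact (norm_add_le _ _).trans (by linarith)
      calc _ = ‖-(Γ (c t + t • w) (u + w) (e t))
            - (Γ (c t + t • w) (u + w) (Z t) + (-(Γ (c t) u (Y x t)) - (Γ (c t) w (Y x t)
              + t • (fderiv ℝ Γ (c t) u w (Y x t) - Γ (c t) w (Γ (c t) u (Y x t))))))‖ := by
            congr 1
            simp only [e, map_sub]
            abel
        _ ≤ ‖Γ (c t + t • w) (u + w) (e t)‖ + 5 * B ^ 4 * δ * ‖w‖ := by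
            refine (norm_sub_le _ _).trans ?_
            rw [norm_neg]
            gcongr
        _ ≤ K * ‖e t‖ + 5 * B ^ 4 * δ * ‖w‖ := by
            gcongr
            exact (ContinuousLinearMap.le_opNorm _ _).trans (by gcongr)) 1 (by simp)
  rw [sub_zero] at hbound
  have hc1 : c 1 = x := by simp [hc, hu]
  have he1 : e 1 = Y (x + w) 1 - Y x 1 - (-(Γ x).flip (Y x 1)) w := by
    simp only [e, Z, one_smul, hc1, neg_apply, ContinuousLinearMap.flip_apply]
    abel
  rw [← he1]
  calc ‖e 1‖ ≤ 5 * B ^ 4 * δ * ‖w‖ * Real.exp K :=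
        hbound.trans (gronwallBound_zero_one_le hK1 (by positivity))
    _ = 5 * B ^ 4 * δ * Real.exp K * ‖w‖ := by ring
    _ ≤ ε * ‖w‖ := by gcongr

/-- A flat `C¹` connection on a trivial bundle over a convex open set has a parallel section through
every initial value. -/
theorem exists_isParallelOn_of_flat [FiniteDimensional ℝ F] {Γ : E → E →L[ℝ] F →L[ℝ] F}
    {Ω : Set E} (hΩ : IsOpen Ω) (hconv : Convex ℝ Ω) (hΓ : ContDiffOn ℝ 1 Γ Ω)
    (hflat : ∀ x ∈ Ω, ∀ u v, connectionCurvature Γ x u v = 0) {p : E} (hp : p ∈ Ω) (w₀ : F) :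
    ∃ s : E → F, s p = w₀ ∧ IsParallelOn Γ s Ω := by
  have hex : ∀ x : E, ∃ y : ℝ → F, x ∈ Ω → y 0 = w₀ ∧ ∀ t ∈ Icc (0 : ℝ) 1,
      HasDerivWithinAt y (-Γ (p + t • (x - p)) (x - p) (y t)) (Icc 0 1) t := fun x ↦ by
    by_cases hx : x ∈ Ω
    · have hc : Continuous fun t : ℝ ↦ p + t • (x - p) := by fun_prop
      have hΓc : ContinuousOn (fun t : ℝ ↦ Γ (p + t • (x - p))) (Icc 0 1) :=
        hΓ.continuousOn.comp hc.continuousOn fun t ht ↦ hconv.add_smul_sub_mem hp hx ht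
      obtain ⟨y, hy0, hy⟩ := exists_solution_linear_ODE
        (A := fun t ↦ -Γ (p + t • (x - p)) (x - p)) (hΓc.clm_apply continuousOn_const).neg w₀
      exact ⟨y, fun _ ↦ ⟨hy0, hy⟩⟩
    · exact ⟨0, fun h ↦ absurd h hx⟩
  choose Y hY using hex
  refine ⟨fun x ↦ Y x 1, ?_, fun x hx ↦ hasFDerivAt_radial_transport hΩ hconv hΓ hflat hp
    (fun x hx ↦ (hY x hx).1) (fun x hx ↦ (hY x hx).2) hx⟩
  have h := eq_zero_of_abs_deriv_le_mul_abs_self_of_eq_zero_right (f := fun t ↦ Y p t - w₀)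
    (f' := fun _ ↦ 0) (K := 0) (a := 0) (b := 1)
    (fun t ht ↦ (((hY p hp).2 t ht).sub_const w₀).continuousWithinAt)
    (fun t ht ↦ by
      simpa using (((hY p hp).2 t (Ico_subset_Icc_self ht)).Ici_of_Icc ht).sub_const w₀)
    (by simp [(hY p hp).1]) (by simp) 1 (by simp)
  exact sub_eq_zero.1 h

theorem IsParallelOn.eq_zero_of_eq_zero {Γ : E → E →L[ℝ] F →L[ℝ] F} {Ω : Set E}
    (hconv : Convex ℝ Ω) (hΓ : ContinuousOn Γ Ω) {s : E → F} (hs : IsParallelOn Γ s Ω)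
    {x y : E} (hx : x ∈ Ω) (hy : y ∈ Ω) (h0 : s x = 0) : s y = 0 := by
  have hmem : ∀ t ∈ Icc (0 : ℝ) 1, x + t • (y - x) ∈ Ω := fun t ht ↦
    hconv.add_smul_sub_mem hx hy ht
  have hc : Continuous fun t : ℝ ↦ x + t • (y - x) := by fun_prop
  have hΓc : ContinuousOn (fun t : ℝ ↦ Γ (x + t • (y - x)) (y - x)) (Icc 0 1) :=
    (hΓ.comp hc.continuousOn hmem).clm_apply continuousOn_const
  obtain ⟨C, hC⟩ := isCompact_Icc.exists_bound_of_continuousOn hΓc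
  have hd : ∀ t ∈ Icc (0 : ℝ) 1, HasDerivAt (fun t : ℝ ↦ s (x + t • (y - x)))
      (-Γ (x + t • (y - x)) (y - x) (s (x + t • (y - x)))) t := fun t ht ↦ by
    have hct : HasDerivAt (fun t : ℝ ↦ x + t • (y - x)) (y - x) t := by
      simpa using ((hasDerivAt_id t).smul_const (y - x)).const_add x
    exact ((hs _ (hmem t ht)).comp_hasDerivAt t hct).congr_deriv (by simp)
  have h := eq_zero_of_abs_deriv_le_mul_abs_self_of_eq_zero_right
    (f := fun t : ℝ ↦ s (x + t • (y - x))) (K := C) (a := 0) (b := 1)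
    (fun t ht ↦ (hd t ht).continuousAt.continuousWithinAt)
    (fun t ht ↦ (hd t (Ico_subset_Icc_self ht)).hasDerivWithinAt) (by simpa using h0)
    (fun t ht ↦ by
      rw [norm_neg]
      refine (ContinuousLinearMap.le_opNorm _ _).trans ?_
      gcongr
      exact hC t (Ico_subset_Icc_self ht)) 1 (by simp)
  simpa using h

/-- Bootstrapping `ds = -Γ s`: a parallel section is one degree smoother than the connection. -/
theorem IsParallelOn.contDiffOn {Γ : E → E →L[ℝ] F →L[ℝ] F} {Ω : Set E} (hΩ : IsOpen Ω) {k : ℕ∞}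
    (hΓ : ContDiffOn ℝ k Γ Ω) {s : E → F} (hs : IsParallelOn Γ s Ω) :
    ContDiffOn ℝ ((k : WithTop ℕ∞) + 1) s Ω := by
  have hdiff : DifferentiableOn ℝ s Ω := fun x hx ↦
    (hs x hx).differentiableAt.differentiableWithinAt
  have step : ∀ r : WithTop ℕ∞, r ≤ k → r ≠ ω → ContDiffOn ℝ r s Ω → ContDiffOn ℝ (r + 1) s Ω := by
    intro r hr hrω hsr
    rw [contDiffOn_succ_iff_fderiv_of_isOpen hΩ]
    refine ⟨hdiff, fun h ↦ absurd h hrω, ?_⟩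
    have hflip : ContDiffOn ℝ r (fun x ↦ (Γ x).flip) Ω :=
      (ContinuousLinearMap.flipₗᵢ ℝ E F F).contDiff.comp_contDiffOn (hΓ.of_le hr)
    exact (hflip.clm_apply hsr).neg.congr fun x hx ↦ (hs x hx).fderiv
  have hnat : ∀ j : ℕ, (j : WithTop ℕ∞) ≤ k → ContDiffOn ℝ ((j : WithTop ℕ∞) + 1) s Ω := by
    intro j
    induction j with
    | zero => exact fun h ↦ step _ h (by simp) (by simpa using hdiff.continuousOn)
    | succ j ih =>
      intro h
      refine step _ h (by simp) ?_
      have := ih (le_trans (by exact_mod_cast Nat.le_succ j) h)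
      exact_mod_cast this
  have hk : ContDiffOn ℝ k s Ω := by
    refine contDiffOn_iff_forall_nat_le.2 fun j hj ↦ ?_
    exact (hnat j (by exact_mod_cast hj)).of_le le_self_add
  exact step _ le_rfl (by simp) hk

/-- The curvature kills the values of a parallel section, by symmetry of the second derivative.
The section need not be assumed `C²`: its derivative `-Γ s` is differentiable. -/
theorem IsParallelOn.connectionCurvature_eq_zero {Γ : E → E →L[ℝ] F →L[ℝ] F} {Ω : Set E}
    (hΩ : IsOpen Ω) {s : E → F} (hs : IsParallelOn Γ s Ω) {x : E} (hx : x ∈ Ω)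
    (hΓ : DifferentiableAt ℝ Γ x) (u v : E) : connectionCurvature Γ x u v (s x) = 0 := by
  let Φ : (E →L[ℝ] F →L[ℝ] F) →L[ℝ] (F →L[ℝ] E →L[ℝ] F) :=
    (ContinuousLinearMap.flipₗᵢ ℝ E F F).toContinuousLinearEquiv.toContinuousLinearMap
  have hflip : HasFDerivAt (fun y ↦ Φ (Γ y)) (Φ.comp (fderiv ℝ Γ x)) x :=
    Φ.hasFDerivAt.comp x hΓ.hasFDerivAt
  have h2 := (hflip.clm_apply (hs x hx)).neg
  have hsymm := second_derivative_symmetric_of_eventually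
    (mem_of_superset (hΩ.mem_nhds hx) hs) h2 u v
  simp [Φ] at hsymm
  rw [connectionCurvature_apply]
  linear_combination (norm := module) (-1 : ℝ) • hsymm

end

/-! ### Vector fields in charts -/

section
variable {n : ℕ} {M : Type*} [TopologicalSpace M]
    [ChartedSpace (EuclideanSpace ℝ (Fin n)) M]

/-- The vector field on the source of the chart `φ` whose coordinate expression is `s`. Off the
source the value carries no meaning. -/
noncomputable def chartField (φ : OpenPartialHomeomorph M (EuclideanSpace ℝ (Fin n)))
    (s : EuclideanSpace ℝ (Fin n) → EuclideanSpace ℝ (Fin n)) (x : M) : TangentSpace (𝓡 n) x :=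
  mpullback (𝓡 n) (𝓡 n) φ s x

/-- The coordinate expression of the vector field `σ` in the chart `φ`, meaningful on the target
of `φ`. -/
noncomputable def chartRep (φ : OpenPartialHomeomorph M (EuclideanSpace ℝ (Fin n)))
    (σ : Π x : M, TangentSpace (𝓡 n) x) (y : EuclideanSpace ℝ (Fin n)) :
    EuclideanSpace ℝ (Fin n) :=
  mpullback (𝓡 n) (𝓡 n) φ.symm σ y

variable {φ : OpenPartialHomeomorph M (EuclideanSpace ℝ (Fin n))} 

/-- The inverse of the derivative of the chart `φ` at `x`, sending the coordinates of a tangent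
vector to the vector. -/
noncomputable def chartFieldAt (φ : OpenPartialHomeomorph M (EuclideanSpace ℝ (Fin n))) (x : M) :
    EuclideanSpace ℝ (Fin n) →L[ℝ] TangentSpace (𝓡 n) x :=
  (mfderiv (𝓡 n) (𝓡 n) φ x).inverse

theorem chartField_apply (s : EuclideanSpace ℝ (Fin n) → EuclideanSpace ℝ (Fin n)) (x : M) :
    chartField φ s x = chartFieldAt φ x (s (φ x)) := rfl

theorem OpenPartialHomeomorph.MDifferentiable.isInvertible_mfderiv
    {E E' H H' M M' : Type*} [NormedAddCommGroup E] [NormedSpace ℝ E] [NormedAddCommGroup E']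
    [NormedSpace ℝ E'] [TopologicalSpace H] [TopologicalSpace H'] {I : ModelWithCorners ℝ E H}
    {I' : ModelWithCorners ℝ E' H'} [TopologicalSpace M] [ChartedSpace H M] [TopologicalSpace M']
    [ChartedSpace H' M'] {e : OpenPartialHomeomorph M M'} (he : e.MDifferentiable I I') {x : M}
    (hx : x ∈ e.source) : (mfderiv I I' e x).IsInvertible :=
  ⟨he.mfderiv hx, rfl⟩

theorem OpenPartialHomeomorph.MDifferentiable.mpullback_mpullback_symm
    {E E' H H' M M' : Type*} [NormedAddCommGroup E] [NormedSpace ℝ E] [NormedAddCommGroup E']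
    [NormedSpace ℝ E'] [TopologicalSpace H] [TopologicalSpace H'] {I : ModelWithCorners ℝ E H}
    {I' : ModelWithCorners ℝ E' H'} [TopologicalSpace M] [ChartedSpace H M] [TopologicalSpace M']
    [ChartedSpace H' M'] {e : OpenPartialHomeomorph M M'} (he : e.MDifferentiable I I') {x : M}
    (hx : x ∈ e.source) (σ : Π x : M, TangentSpace I x) :
    mpullback I I' e (mpullback I' I e.symm σ) x = σ x := by
  have hcomp : mpullback I I (e.symm ∘ e) σ x = mpullback I I' e (mpullback I' I e.symm σ) x := by
    have := mpullbackWithin_comp_of_left (g := e.symm) (f := e) (V := σ) (s := univ) (t := univ)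
      (he.mdifferentiableAt hx).mdifferentiableWithinAt (mapsTo_univ _ _)
      (uniqueMDiffWithinAt_univ I)
      (by rw [mfderivWithin_univ]; exact he.symm.isInvertible_mfderiv (e.map_source hx))
    simpa only [mpullbackWithin_univ] using this
  rw [← hcomp]
  have hid : e.symm ∘ e =ᶠ[𝓝 x] id := by
    filter_upwards [e.open_source.mem_nhds hx] with y hy using e.left_inv hy
  have hm : mfderiv I I (e.symm ∘ e) x = mfderiv I I id x := hid.mfderiv_eq
  have heq : ∀ z, z = x → ((ContinuousLinearMap.id ℝ E).inverse (σ z : E) : E) = (σ x : E) := by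
    rintro _ rfl
    rw [ContinuousLinearMap.inverse_id]
    rfl
  rw [mpullback_apply, hm, mfderiv_id]
  exact heq _ (e.left_inv hx)

theorem mdifferentiable_of_mem_maximalAtlas (hφ : φ ∈ IsManifold.maximalAtlas (𝓡 n) ∞ M) :
    φ.MDifferentiable (𝓡 n) (𝓡 n) :=
  ⟨(contMDiffOn_of_mem_maximalAtlas hφ).mdifferentiableOn (by simp),
    (contMDiffOn_symm_of_mem_maximalAtlas hφ).mdifferentiableOn (by simp)⟩

theorem chartField_chartRep (hφ : φ ∈ IsManifold.maximalAtlas (𝓡 n) ∞ M) {x : M}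
    (hx : x ∈ φ.source) (σ : Π x : M, TangentSpace (𝓡 n) x) :
    chartField φ (chartRep φ σ) x = σ x :=
  (mdifferentiable_of_mem_maximalAtlas hφ).mpullback_mpullback_symm hx σ

variable [IsManifold (𝓡 n) ∞ M]

theorem contMDiffAt_chartField (hφ : φ ∈ IsManifold.maximalAtlas (𝓡 n) ∞ M) {x : M}
    (hx : x ∈ φ.source) {r : ℕ∞} {s : EuclideanSpace ℝ (Fin n) → EuclideanSpace ℝ (Fin n)}
    (hs : ContDiffAt ℝ r s (φ x)) :
    ContMDiffAt (𝓡 n) (𝓡 n).tangent r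
      (fun x ↦ (chartField φ s x : TangentBundle (𝓡 n) M)) x :=
  ContMDiffAt.mpullback_vectorField_preimage (n := ∞)
    (contMDiffAt_vectorSpace_iff_contDiffAt.2 hs)
    (contMDiffAt_of_mem_maximalAtlas hφ hx)
    ((mdifferentiable_of_mem_maximalAtlas hφ).isInvertible_mfderiv hx)
    (by exact_mod_cast le_top)

theorem contDiffAt_chartRep (hφ : φ ∈ IsManifold.maximalAtlas (𝓡 n) ∞ M)
    {y : EuclideanSpace ℝ (Fin n)} (hy : y ∈ φ.target) {r : ℕ∞} {σ : Π x : M, TangentSpace (𝓡 n) x}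
    (hσ : ContMDiffAt (𝓡 n) (𝓡 n).tangent r (fun x ↦ (σ x : TangentBundle (𝓡 n) M)) (φ.symm y)) :
    ContDiffAt ℝ r (chartRep φ σ) y :=
  contMDiffAt_vectorSpace_iff_contDiffAt.1 <|
    ContMDiffAt.mpullback_vectorField_preimage (n := ∞) hσ
      (contMDiffAt_symm_of_mem_maximalAtlas hφ hy)
      ((mdifferentiable_of_mem_maximalAtlas hφ).symm.isInvertible_mfderiv hy)
      (by exact_mod_cast le_top)

/-- A vector field which is smooth on an open set agrees near any point of the set with a globally
smooth one. -/
theorem exists_contMDiff_eventuallyEq [T2Space M] {U : Set M} (hU : IsOpen U) {x : M} (hx : x ∈ U)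
    {σ : Π x : M, TangentSpace (𝓡 n) x}
    (hσ : ContMDiffOn (𝓡 n) (𝓡 n).tangent ∞ (fun x ↦ (σ x : TangentBundle (𝓡 n) M)) U) :
    ∃ τ : Π x : M, TangentSpace (𝓡 n) x,
      ContMDiff (𝓡 n) (𝓡 n).tangent ∞ (fun x ↦ (τ x : TangentBundle (𝓡 n) M)) ∧
      ∀ᶠ y in 𝓝 x, τ y = σ y := by
  obtain ⟨f, -, hf⟩ := (SmoothBumpFunction.nhds_basis_tsupport (I := 𝓡 n) x).mem_iff.1
    (hU.mem_nhds hx)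
  refine ⟨(f : M → ℝ) • σ,
    ContMDiffOn.smul_section_of_tsupport f.contMDiff.contMDiffOn hU hf hσ, ?_⟩
  filter_upwards [f.eventuallyEq_one] with y hy
  simp [hy]
end

/-! ### Christoffel symbols -/

theorem EuclideanSpace.sum_smul_single {n : ℕ} (v : EuclideanSpace ℝ (Fin n)) :
    ∑ i, v i • (EuclideanSpace.single i 1 : EuclideanSpace ℝ (Fin n)) = v := by
  have := (EuclideanSpace.basisFun (Fin n) ℝ).sum_repr v
  simpa using this

section
variable {n : ℕ} {M : Type*} [TopologicalSpace M]
    [ChartedSpace (EuclideanSpace ℝ (Fin n)) M] [IsManifold (𝓡 n) ∞ M]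
    {φ : OpenPartialHomeomorph M (EuclideanSpace ℝ (Fin n))}

namespace LinearConnection

theorem congr_of_eventuallyEq (D : LinearConnection n M) {σ τ : Π x : M, TangentSpace (𝓡 n) x}
    {x : M} (h : ∀ᶠ y in 𝓝 x, σ y = τ y)
    (hτ : MDifferentiableAt (𝓡 n) (𝓡 n).tangent (fun x ↦ (τ x : TangentBundle (𝓡 n) M)) x) :
    D σ x = D τ x := by
  have hσ : MDifferentiableAt (𝓡 n) (𝓡 n).tangent
      (fun x ↦ (σ x : TangentBundle (𝓡 n) M)) x :=
    hτ.congr_of_eventuallyEq (h.mono fun y hy ↦ by simp only [hy])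
  exact D.isCovariantDerivativeOnUniv.congr_of_eventuallyEq hσ hτ univ_mem h

theorem apply_sum (D : LinearConnection n M) {ι : Type*} (t : Finset ι)
    {σ : ι → Π x : M, TangentSpace (𝓡 n) x} {x : M}
    (hσ : ∀ i, MDifferentiableAt (𝓡 n) (𝓡 n).tangent
      (fun x ↦ (σ i x : TangentBundle (𝓡 n) M)) x) :
    D (∑ i ∈ t, σ i) x = ∑ i ∈ t, D (σ i) x := by
  classical
  induction t using Finset.induction_on with
  | empty => simp
  | insert a t ha ih =>
    rw [Finset.sum_insert ha, Finset.sum_insert ha, ← ih]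
    refine D.isCovariantDerivativeOnUniv.add (hσ a) ?_
    have := MDifferentiableAt.sum_section (s := t) (fun i _ ↦ hσ i)
    refine this.congr_of_eventuallyEq (Eventually.of_forall fun y ↦ ?_)
    simp

/-- The coordinate expression of `∇_{∂_i} ∂_j` for the coordinate fields of the chart `φ`. -/
noncomputable def christoffelVec (D : LinearConnection n M)
    (φ : OpenPartialHomeomorph M (EuclideanSpace ℝ (Fin n))) (i j : Fin n) :
    EuclideanSpace ℝ (Fin n) → EuclideanSpace ℝ (Fin n) :=
  chartRep φ fun x ↦ D (chartField φ fun _ ↦ EuclideanSpace.single j 1) x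
    (chartField φ (fun _ ↦ EuclideanSpace.single i 1) x)

/-- The Christoffel symbols of the connection in the chart `φ`, as a bilinear map: `Γ y v w` is the
coordinate expression of `∇_v w` at `y`, for constant coordinate fields `v` and `w`. -/
noncomputable def christoffel (D : LinearConnection n M)
    (φ : OpenPartialHomeomorph M (EuclideanSpace ℝ (Fin n))) (y : EuclideanSpace ℝ (Fin n)) :
    EuclideanSpace ℝ (Fin n) →L[ℝ] EuclideanSpace ℝ (Fin n) →L[ℝ] EuclideanSpace ℝ (Fin n) :=
  ∑ i, ∑ j, (EuclideanSpace.proj i : EuclideanSpace ℝ (Fin n) →L[ℝ] ℝ).smulRight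
    ((EuclideanSpace.proj j : EuclideanSpace ℝ (Fin n) →L[ℝ] ℝ).smulRight
      (D.christoffelVec φ i j y))

theorem christoffel_apply (D : LinearConnection n M) (y v w : EuclideanSpace ℝ (Fin n)) :
    D.christoffel φ y v w = ∑ i, ∑ j, (v i * w j) • D.christoffelVec φ i j y := by
  simp [christoffel, mul_smul]

omit [IsManifold (𝓡 n) ∞ M] in
theorem mfderiv_comp_chart (hφ : φ ∈ IsManifold.maximalAtlas (𝓡 n) ∞ M) {x : M}
    (hx : x ∈ φ.source) {f : EuclideanSpace ℝ (Fin n) → ℝ} (hf : DifferentiableAt ℝ f (φ x))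
    (v : EuclideanSpace ℝ (Fin n)) :
    mvfderiv (𝓡 n) (f ∘ φ) x (chartFieldAt φ x v) = fderiv ℝ f (φ x) v := by
  have he := mdifferentiable_of_mem_maximalAtlas hφ
  have h1 : mfderiv (𝓡 n) 𝓘(ℝ, ℝ) (f ∘ φ) x =
      (mfderiv (𝓡 n) 𝓘(ℝ, ℝ) f (φ x)).comp (mfderiv (𝓡 n) (𝓡 n) φ x) :=
    mfderiv_comp x hf.mdifferentiableAt (he.mdifferentiableAt hx)
  have h2 : mfderiv (𝓡 n) (𝓡 n) φ x (chartFieldAt φ x v) = v :=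
    (he.isInvertible_mfderiv hx).self_apply_inverse v
  change (mfderiv (𝓡 n) 𝓘(ℝ, ℝ) (f ∘ φ) x) (chartFieldAt φ x v) = _
  rw [h1, ← mfderiv_eq_fderiv]
  exact congrArg _ h2

/-- The coordinate formula `∇_v s = ds(v) + Γ(v) s`. -/
theorem apply_chartField (D : LinearConnection n M)
    (hφ : φ ∈ IsManifold.maximalAtlas (𝓡 n) ∞ M) {x : M} (hx : x ∈ φ.source)
    {s : EuclideanSpace ℝ (Fin n) → EuclideanSpace ℝ (Fin n)} (hs : DifferentiableAt ℝ s (φ x))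
    (v : EuclideanSpace ℝ (Fin n)) :
    D (chartField φ s) x (chartFieldAt φ x v) =
      chartFieldAt φ x (fderiv ℝ s (φ x) v + D.christoffel φ (φ x) v (s (φ x))) := by
  have he := mdifferentiable_of_mem_maximalAtlas hφ
  have hsj : ∀ j, DifferentiableAt ℝ (fun y ↦ s y j) (φ x) := fun j ↦
    (EuclideanSpace.proj j : EuclideanSpace ℝ (Fin n) →L[ℝ] ℝ).differentiableAt.comp _ hs
  have hfield : ∀ j, MDifferentiableAt (𝓡 n) (𝓡 n).tangent (fun x ↦ (chartField φ (fun _ ↦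
      EuclideanSpace.single j 1) x : TangentBundle (𝓡 n) M)) x := fun j ↦
    (contMDiffAt_chartField hφ hx (r := 1) contDiffAt_const).mdifferentiableAt one_ne_zero
  have hcoef : ∀ j, MDifferentiableAt (𝓡 n) 𝓘(ℝ, ℝ) ((fun y ↦ s y j) ∘ φ) x := fun j ↦
    (hsj j).mdifferentiableAt.comp x (he.mdifferentiableAt hx)
  have hdecomp : chartField φ s = ∑ j, ((fun y ↦ s y j) ∘ φ) •
      (chartField φ (fun _ ↦ EuclideanSpace.single j 1) : Π x : M, TangentSpace (𝓡 n) x) := by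
    funext z
    rw [Finset.sum_apply]
    simp only [Pi.smul_apply', chartField_apply, Function.comp_apply, ← map_smul, ← map_sum]
    rw [EuclideanSpace.sum_smul_single]
  have hD : ∀ j, D (chartField φ fun _ ↦ EuclideanSpace.single j 1) x (chartFieldAt φ x v) =
      chartFieldAt φ x (∑ i, v i • D.christoffelVec φ i j (φ x)) := fun j ↦ by
    conv_lhs => rw [← EuclideanSpace.sum_smul_single v, map_sum, map_sum]
    rw [map_sum]
    refine Finset.sum_congr rfl fun i _ ↦ ?_
    rw [map_smul, map_smul, map_smul]
    congr 1
    exact (chartField_chartRep hφ hx (fun x ↦ D (chartField φ fun _ ↦ EuclideanSpace.single j 1) x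
      (chartField φ (fun _ ↦ EuclideanSpace.single i 1) x))).symm
  rw [hdecomp, apply_sum D _ fun j ↦ (hcoef j).smul_section (hfield j)]
  simp only [D.isCovariantDerivativeOnUniv.leibniz (hfield _) (hcoef _)]
  rw [sum_apply]
  have hterm : ∀ j, (((fun y ↦ s y j) ∘ φ) x • D (chartField φ fun _ ↦ EuclideanSpace.single j 1) x
      + (mvfderiv (𝓡 n) ((fun y ↦ s y j) ∘ φ) x).smulRight
        (chartField φ (fun _ ↦ EuclideanSpace.single j 1) x)) (chartFieldAt φ x v) =
      chartFieldAt φ x (s (φ x) j • (∑ i, v i • D.christoffelVec φ i j (φ x)) +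
        (fderiv ℝ s (φ x) v) j • EuclideanSpace.single j 1) := fun j ↦ by
    rw [add_apply, smul_apply, hD, ContinuousLinearMap.smulRight_apply,
      mfderiv_comp_chart hφ hx (hsj j), chartField_apply, map_add, map_smul, map_smul]
    congr 2
    have := ((EuclideanSpace.proj j : EuclideanSpace ℝ (Fin n) →L[ℝ] ℝ).hasFDerivAt.comp (φ x)
      hs.hasFDerivAt).fderiv
    exact congrArg (· v) this
  simp only [hterm]
  rw [← map_sum, Finset.sum_add_distrib, EuclideanSpace.sum_smul_single, add_comm,
    christoffel_apply, Finset.sum_comm]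
  congr 2
  refine Finset.sum_congr rfl fun j _ ↦ ?_
  rw [Finset.smul_sum]
  refine Finset.sum_congr rfl fun i _ ↦ ?_
  rw [smul_smul, mul_comm]

theorem contDiffOn_christoffel [T2Space M] (D : LinearConnection n M) {k : ℕ∞}
    (hD : CovariantDerivative.ContMDiffCovariantDerivative D (k : WithTop ℕ∞))
    (hφ : φ ∈ IsManifold.maximalAtlas (𝓡 n) ∞ M) :
    ContDiffOn ℝ k (D.christoffel φ) φ.target := by
  have hvec : ∀ i j, ContDiffOn ℝ k (D.christoffelVec φ i j) φ.target := fun i j y hy ↦ by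
    have hfield : ∀ (i : Fin n) {x : M}, x ∈ φ.source → ContMDiffAt (𝓡 n) (𝓡 n).tangent ∞
        (fun x ↦ (chartField φ (fun _ ↦ EuclideanSpace.single i 1) x : TangentBundle (𝓡 n) M)) x :=
      fun i x hx ↦ contMDiffAt_chartField hφ hx (r := ⊤) contDiffAt_const
    refine (contDiffAt_chartRep hφ hy ?_).contDiffWithinAt
    have hx : φ.symm y ∈ φ.source := φ.map_target hy
    set x := φ.symm y
    obtain ⟨τ, hτ, hτeq⟩ := exists_contMDiff_eventuallyEq φ.open_source hx
      (fun z hz ↦ (hfield j hz).contMDiffWithinAt)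
    have hDτ := hD.contMDiff.contMDiff (σ := τ) (hτ.contMDiffOn.of_le (by exact_mod_cast le_top))
    have happ := ContMDiffAt.clm_bundle_apply (hDτ.contMDiffAt univ_mem)
      ((hfield i hx).of_le (m := (k : WithTop ℕ∞)) (by exact_mod_cast le_top))
    refine happ.congr_of_eventuallyEq ?_
    filter_upwards [hτeq.eventually_nhds] with z hz
    have : D (chartField φ fun _ ↦ EuclideanSpace.single j 1) z = D τ z :=
      D.congr_of_eventuallyEq (hz.mono fun _ h ↦ h.symm) (hτ.mdifferentiableAt (by simp))
    simp only [this]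
  unfold christoffel
  refine ContDiffOn.sum fun i _ ↦ ContDiffOn.sum fun j _ ↦ ?_
  exact contDiffOn_const.smulRight (contDiffOn_const.smulRight (hvec i j))

end LinearConnection
end

/-! ### Curvature in a chart -/

section
variable {n : ℕ} {M : Type*} [TopologicalSpace M]
    [ChartedSpace (EuclideanSpace ℝ (Fin n)) M] [IsManifold (𝓡 n) ∞ M]
    {φ : OpenPartialHomeomorph M (EuclideanSpace ℝ (Fin n))}

omit [IsManifold (𝓡 n) ∞ M] in
theorem exists_chartFieldAt_eq (hφ : φ ∈ IsManifold.maximalAtlas (𝓡 n) ∞ M) {x : M}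
    (hx : x ∈ φ.source) :
    ∃ e : EuclideanSpace ℝ (Fin n) ≃L[ℝ] TangentSpace (𝓡 n) x, ∀ v, chartFieldAt φ x v = e v := by
  refine ⟨((mdifferentiable_of_mem_maximalAtlas hφ).mfderiv hx).symm, fun v ↦ ?_⟩
  exact DFunLike.congr_fun (ContinuousLinearMap.inverse_equiv
    ((mdifferentiable_of_mem_maximalAtlas hφ).mfderiv hx)) v

theorem mlieBracket_chartField (hφ : φ ∈ IsManifold.maximalAtlas (𝓡 n) ∞ M) {x : M}
    (hx : x ∈ φ.source) {X Y : EuclideanSpace ℝ (Fin n) → EuclideanSpace ℝ (Fin n)}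
    (hX : ContDiffAt ℝ 1 X (φ x)) (hY : ContDiffAt ℝ 1 Y (φ x)) :
    mlieBracket (𝓡 n) (chartField φ X) (chartField φ Y) x =
      chartFieldAt φ x (lieBracket ℝ X Y (φ x)) := by
  have h2 : minSmoothness ℝ 2 ≤ ∞ := by
    rw [minSmoothness_of_isRCLikeNormedField]
    exact WithTop.coe_le_coe.2 (le_top : (2 : ℕ∞) ≤ ⊤)
  have : IsManifold (𝓡 n) (minSmoothness ℝ 2) M := IsManifold.of_le h2
  have h := mpullback_mlieBracket (I := 𝓡 n) (I' := 𝓡 n) (V := X) (W := Y) (n := ∞)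
    ((contMDiffAt_vectorSpace_iff_contDiffAt.2 hX).mdifferentiableAt one_ne_zero)
    ((contMDiffAt_vectorSpace_iff_contDiffAt.2 hY).mdifferentiableAt one_ne_zero)
    (contMDiffAt_of_mem_maximalAtlas hφ hx) h2
  have hE : mlieBracket (𝓡 n) X Y = lieBracket ℝ X Y :=
    mlieBracketWithin_univ.symm.trans
      (mlieBracketWithin_eq_lieBracketWithin.trans lieBracketWithin_univ)
  exact h.symm.trans (congrArg (chartFieldAt φ x) (congrFun hE (φ x)))

namespace LinearConnection

/-- The coordinate formula for `∇_Y Z` as an identity of germs at `x`, so that `∇` can be applied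
to it again. -/
theorem eventually_apply_eq (D : LinearConnection n M)
    (hφ : φ ∈ IsManifold.maximalAtlas (𝓡 n) ∞ M) {x : M} (hx : x ∈ φ.source)
    {Y Z : Π x : M, TangentSpace (𝓡 n) x}
    {Y' Z' : EuclideanSpace ℝ (Fin n) → EuclideanSpace ℝ (Fin n)}
    (hY : ∀ᶠ z in 𝓝 x, Y z = chartField φ Y' z) (hZ : ∀ᶠ z in 𝓝 x, Z z = chartField φ Z' z)
    (hZ' : ContDiffAt ℝ 1 Z' (φ x)) :
    ∀ᶠ z in 𝓝 x, D Z z (Y z) = chartField φ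
      (fun y ↦ fderiv ℝ Z' y (Y' y) + D.christoffel φ y (Y' y) (Z' y)) z := by
  have hdiff : ∀ᶠ z in 𝓝 x, ContDiffAt ℝ 1 Z' (φ z) :=
    (φ.continuousAt hx).eventually (hZ'.eventually (by simp))
  filter_upwards [hY, hZ.eventually_nhds, hdiff, φ.open_source.mem_nhds hx] with z h1 h2 h3 hz
  rw [D.congr_of_eventuallyEq h2
    ((contMDiffAt_chartField hφ hz (r := 1) h3).mdifferentiableAt one_ne_zero), h1]
  exact D.apply_chartField hφ hz (h3.differentiableAt one_ne_zero) _

/-- In a chart, the curvature operator is the curvature of the Christoffel symbols. -/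
theorem curvature_eq (D : LinearConnection n M)
    (hφ : φ ∈ IsManifold.maximalAtlas (𝓡 n) ∞ M) {x : M} (hx : x ∈ φ.source)
    (hΓ : ContDiffAt ℝ 1 (D.christoffel φ) (φ x))
    {X Y Z : Π x : M, TangentSpace (𝓡 n) x}
    {X' Y' Z' : EuclideanSpace ℝ (Fin n) → EuclideanSpace ℝ (Fin n)}
    (hX : ∀ᶠ z in 𝓝 x, X z = chartField φ X' z) (hY : ∀ᶠ z in 𝓝 x, Y z = chartField φ Y' z)
    (hZ : ∀ᶠ z in 𝓝 x, Z z = chartField φ Z' z) (hX' : ContDiffAt ℝ 1 X' (φ x))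
    (hY' : ContDiffAt ℝ 1 Y' (φ x)) (hZ' : ContDiffAt ℝ 2 Z' (φ x)) :
    D.curvature X Y Z x = chartFieldAt φ x (connectionCurvature (D.christoffel φ) (φ x)
      (X' (φ x)) (Y' (φ x)) (Z' (φ x))) := by
  have hZ1 : ContDiffAt ℝ 1 Z' (φ x) := hZ'.of_le one_le_two
  have hdZ : ContDiffAt ℝ 1 (fderiv ℝ Z') (φ x) := hZ'.fderiv_right le_rfl
  -- the iterated derivative `∇_V ∇_W Z` in the chart, expanded by the product rule
  have key : ∀ {V W : Π x : M, TangentSpace (𝓡 n) x}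
      {V' W' : EuclideanSpace ℝ (Fin n) → EuclideanSpace ℝ (Fin n)},
      (∀ᶠ z in 𝓝 x, V z = chartField φ V' z) → (∀ᶠ z in 𝓝 x, W z = chartField φ W' z) →
      ContDiffAt ℝ 1 W' (φ x) →
      D (fun y ↦ D Z y (W y)) x (V x) = chartFieldAt φ x
        (fderiv ℝ (fderiv ℝ Z') (φ x) (V' (φ x)) (W' (φ x))
          + fderiv ℝ Z' (φ x) (fderiv ℝ W' (φ x) (V' (φ x)))
          + (fderiv ℝ (D.christoffel φ) (φ x) (V' (φ x)) (W' (φ x)) (Z' (φ x))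
          + D.christoffel φ (φ x) (fderiv ℝ W' (φ x) (V' (φ x))) (Z' (φ x))
          + D.christoffel φ (φ x) (W' (φ x)) (fderiv ℝ Z' (φ x) (V' (φ x))))
          + D.christoffel φ (φ x) (V' (φ x)) (fderiv ℝ Z' (φ x) (W' (φ x))
            + D.christoffel φ (φ x) (W' (φ x)) (Z' (φ x)))) := by
    intro V W V' W' hV hW hW'
    have hS : ContDiffAt ℝ 1
        (fun y ↦ fderiv ℝ Z' y (W' y) + D.christoffel φ y (W' y) (Z' y)) (φ x) :=
      (hdZ.clm_apply hW').add ((hΓ.clm_apply hW').clm_apply hZ1)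
    rw [D.congr_of_eventuallyEq (D.eventually_apply_eq hφ hx hW hZ hZ1)
      ((contMDiffAt_chartField hφ hx (r := 1) hS).mdifferentiableAt one_ne_zero),
      hV.self_of_nhds, chartField_apply,
      D.apply_chartField hφ hx (hS.differentiableAt one_ne_zero)]
    have hW1 := (hW'.differentiableAt one_ne_zero).hasFDerivAt
    have hd := ((hdZ.differentiableAt one_ne_zero).hasFDerivAt.clm_apply hW1).add
      (((hΓ.differentiableAt one_ne_zero).hasFDerivAt.clm_apply hW1).clm_apply
        (hZ1.differentiableAt one_ne_zero).hasFDerivAt)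
    have hd' : fderiv ℝ (fun y ↦ fderiv ℝ Z' y (W' y) + D.christoffel φ y (W' y) (Z' y)) (φ x)
      = _ := hd.fderiv
    rw [hd']
    congr 1
    simp
    abel
  have hbr : mlieBracket (𝓡 n) X Y x = chartFieldAt φ x (lieBracket ℝ X' Y' (φ x)) := by
    rw [← mlieBracket_chartField hφ hx hX' hY']
    exact Filter.EventuallyEq.mlieBracket_vectorField_eq hX hY
  have hsymm : fderiv ℝ (fderiv ℝ Z') (φ x) (X' (φ x)) (Y' (φ x))
      = fderiv ℝ (fderiv ℝ Z') (φ x) (Y' (φ x)) (X' (φ x)) :=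
    (hZ'.isSymmSndFDerivAt (by simp)).eq _ _
  have hDZ : D Z x = D (chartField φ Z') x := D.congr_of_eventuallyEq hZ
    ((contMDiffAt_chartField hφ hx (r := 1) hZ1).mdifferentiableAt one_ne_zero)
  rw [curvature, key hX hY hY', key hY hX hX', hbr, hDZ,
    D.apply_chartField hφ hx (hZ1.differentiableAt one_ne_zero), ← map_sub, ← map_sub]
  congr 1
  rw [connectionCurvature_apply, hsymm, lieBracket]
  simp only [map_add, map_sub, sub_apply]
  abel

end LinearConnection
end

/-! ### Parallel bases and flatness -/

section
variable {n : ℕ} {M : Type*} [TopologicalSpace M] [T2Space M]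
    [ChartedSpace (EuclideanSpace ℝ (Fin n)) M] [IsManifold (𝓡 n) ∞ M]
    {φ : OpenPartialHomeomorph M (EuclideanSpace ℝ (Fin n))}

namespace LinearConnection

omit [T2Space M] in
theorem apply_eq_zero_of_components_eq_zero (D : LinearConnection n M) {m : ℕ∞} {V : Set M}
    {B : Fin n → Π x : M, TangentSpace (𝓡 n) x}
    (hB : IsLocalFrameOn (𝓡 n) (EuclideanSpace ℝ (Fin n)) m B V) {x : M} (hx : x ∈ V)
    (h : ∀ i j k, D.components hB i j k x = 0) (j : Fin n) : D (B j) x = 0 := by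
  have h1 : ∀ k, D (B j) x (B k x) = 0 := fun k ↦ by
    have := hB.eq_of_coeff_eq hx (t := fun x ↦ D (B j) x (B k x)) (t' := 0)
      (fun i ↦ (h i j k).trans (by simp))
    exact this
  have h2 : (D (B j) x).toLinearMap = 0 := (hB.toBasisAt hx).ext fun k ↦ by simpa using h1 k
  ext1 v
  exact DFunLike.congr_fun h2 v

/-- The curvature at a point only involves the values of the fields there, and it kills the vectors
of the parallel basis, hence everything. -/
theorem HasVanishingComponentsBasis.isFlatOn {D : LinearConnection n M} {k m : ℕ∞}
    (hk : 1 ≤ k) (hD : CovariantDerivative.ContMDiffCovariantDerivative D (k : WithTop ℕ∞))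
    (hm : 1 ≤ m) {V : Set M} (hV : IsOpen V) (h : D.HasVanishingComponentsBasis m V) :
    D.IsFlatOn V := by
  obtain ⟨B, hB, hcomp⟩ := h
  intro X Y Z hX hY hZ x hx
  set φ := chartAt (EuclideanSpace ℝ (Fin n)) x with hφdef
  have hφ : φ ∈ IsManifold.maximalAtlas (𝓡 n) ∞ M := IsManifold.chart_mem_maximalAtlas x
  have hxs : x ∈ φ.source := mem_chart_source _ x
  have hΓ : ContDiffOn ℝ 1 (D.christoffel φ) φ.target :=
    (D.contDiffOn_christoffel hD hφ).of_le (by exact_mod_cast hk)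
  have hΓx : ContDiffAt ℝ 1 (D.christoffel φ) (φ x) :=
    hΓ.contDiffAt (φ.open_target.mem_nhds (φ.map_source hxs))
  have hrep : ∀ σ : Π x : M, TangentSpace (𝓡 n) x,
      ∀ z ∈ φ.source, σ z = chartField φ (chartRep φ σ) z :=
    fun σ z hz ↦ (chartField_chartRep hφ hz σ).symm
  have hrep' : ∀ σ : Π x : M, TangentSpace (𝓡 n) x, ∀ z ∈ φ.source,
      ∀ᶠ z' in 𝓝 z, σ z' = chartField φ (chartRep φ σ) z' := fun σ z hz ↦
    mem_of_superset (φ.open_source.mem_nhds hz) (hrep σ)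
  have hsm : ∀ {σ : Π x : M, TangentSpace (𝓡 n) x},
      ContMDiff (𝓡 n) (𝓡 n).tangent ∞ (fun x ↦ (σ x : TangentBundle (𝓡 n) M)) →
      ContDiffAt ℝ 2 (chartRep φ σ) (φ x) := fun hσ ↦
    contDiffAt_chartRep hφ (φ.map_source hxs) (r := 2)
      ((hσ _).of_le (by exact_mod_cast le_top))
  rw [D.curvature_eq hφ hxs hΓx (hrep' X x hxs) (hrep' Y x hxs) (hrep' Z x hxs)
    ((hsm hX).of_le one_le_two) ((hsm hY).of_le one_le_two) (hsm hZ)]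
  -- the representatives of the frame are parallel for the Christoffel symbols
  have hΩ : IsOpen (φ.target ∩ φ.symm ⁻¹' V) := φ.isOpen_inter_preimage_symm hV
  have hpar : ∀ j, IsParallelOn (D.christoffel φ) (chartRep φ (B j)) (φ.target ∩ φ.symm ⁻¹' V) := by
    rintro j y ⟨hy, hyV⟩
    have hz : φ.symm y ∈ φ.source := φ.map_target hy
    obtain ⟨e, he⟩ := exists_chartFieldAt_eq hφ hz
    have hBj : ContMDiffAt (𝓡 n) (𝓡 n).tangent ((1 : ℕ∞) : WithTop ℕ∞)
        (fun x ↦ (B j x : TangentBundle (𝓡 n) M)) (φ.symm y) :=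
      (hB.contMDiffAt hV hyV j).of_le (by exact_mod_cast hm)
    have hs : DifferentiableAt ℝ (chartRep φ (B j)) y :=
      (contDiffAt_chartRep hφ hy hBj).differentiableAt (by simp)
    have h0 : D (chartField φ (chartRep φ (B j))) (φ.symm y) = 0 := by
      rw [← D.apply_eq_zero_of_components_eq_zero hB hyV
        (fun i j k ↦ hcomp i j k _ hyV) j]
      exact D.congr_of_eventuallyEq ((hrep' (B j) _ hz).mono fun _ h ↦ h.symm)
        (hBj.mdifferentiableAt (by simp))
    refine hs.hasFDerivAt.congr_fderiv ?_
    ext1 v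
    have h1 := D.apply_chartField hφ hz (s := chartRep φ (B j))
      (by rwa [φ.right_inv hy]) v
    rw [h0, φ.right_inv hy, he (_ + _)] at h1
    have h2 := e.map_eq_zero_iff.1 h1.symm
    exact eq_neg_of_add_eq_zero_left h2
  obtain ⟨e, he⟩ := exists_chartFieldAt_eq hφ hxs
  have hK : (connectionCurvature (D.christoffel φ) (φ x) (chartRep φ X (φ x))
      (chartRep φ Y (φ x))).toLinearMap = 0 := by
    refine ((hB.toBasisAt hx).map e.symm.toLinearEquiv).ext fun j ↦ ?_
    have hj : ((hB.toBasisAt hx).map e.symm.toLinearEquiv) j = chartRep φ (B j) (φ x) := by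
      rw [Module.Basis.map_apply, IsLocalFrameOn.toBasisAt_coe]
      refine e.injective ((e.apply_symm_apply _).trans ?_)
      rw [← he]
      exact hrep (B j) x hxs
    rw [hj]
    exact (hpar j).connectionCurvature_eq_zero hΩ
      ⟨φ.map_source hxs, by simpa [φ.left_inv hxs] using hx⟩
      (hΓx.differentiableAt one_ne_zero) _ _
  rw [show connectionCurvature (D.christoffel φ) (φ x) (chartRep φ X (φ x))
    (chartRep φ Y (φ x)) (chartRep φ Z (φ x)) = 0 from DFunLike.congr_fun hK _, map_zero]

/-- Flatness is tested on globally smooth fields, so the constant coordinate fields have to be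
extended from a neighbourhood of `x` to all of `M`. -/
theorem IsFlatOn.connectionCurvature_christoffel_eq_zero {D : LinearConnection n M} {U : Set M}
    (h : D.IsFlatOn U) (hφ : φ ∈ IsManifold.maximalAtlas (𝓡 n) ∞ M) {x : M} (hxU : x ∈ U)
    (hx : x ∈ φ.source) (hΓ : ContDiffAt ℝ 1 (D.christoffel φ) (φ x))
    (u v : EuclideanSpace ℝ (Fin n)) : connectionCurvature (D.christoffel φ) (φ x) u v = 0 := by
  have hext : ∀ w : EuclideanSpace ℝ (Fin n), ∃ τ : Π x : M, TangentSpace (𝓡 n) x,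
      ContMDiff (𝓡 n) (𝓡 n).tangent ∞ (fun x ↦ (τ x : TangentBundle (𝓡 n) M)) ∧
      ∀ᶠ y in 𝓝 x, τ y = chartField φ (fun _ ↦ w) y := fun w ↦
    exists_contMDiff_eventuallyEq φ.open_source hx fun z hz ↦
      (contMDiffAt_chartField hφ hz (r := ⊤) contDiffAt_const).contMDiffWithinAt
  ext1 w
  obtain ⟨X, hX, hX'⟩ := hext u
  obtain ⟨Y, hY, hY'⟩ := hext v
  obtain ⟨Z, hZ, hZ'⟩ := hext w
  have h0 := h X Y Z hX hY hZ x hxU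
  rw [D.curvature_eq hφ hx hΓ hX' hY' hZ' contDiffAt_const contDiffAt_const contDiffAt_const] at h0
  obtain ⟨e, he⟩ := exists_chartFieldAt_eq hφ hx
  rw [he] at h0
  exact e.map_eq_zero_iff.1 h0

theorem IsFlatOn.hasVanishingComponentsBasis {D : LinearConnection n M} {k m : ℕ∞}
    (hk : 1 ≤ k) (hD : CovariantDerivative.ContMDiffCovariantDerivative D (k : WithTop ℕ∞))
    (hmk : m ≤ k + 1) {U : Set M} (hU : IsOpen U) (hconv : IsCoordinateConvex n U)
    (h : D.IsFlatOn U) : D.HasVanishingComponentsBasis m U := by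
  obtain ⟨φ, hφ, hUφ, hconv⟩ := hconv
  rcases U.eq_empty_or_nonempty with rfl | ⟨p, hp⟩
  · exact ⟨0, ⟨fun hx ↦ hx.elim, fun hx ↦ hx.elim, fun i x hx ↦ hx.elim⟩,
      fun _ _ _ _ hx ↦ hx.elim⟩
  have hΩ : IsOpen (φ '' U) := φ.isOpen_image_of_subset_source hU hUφ
  have hΩt : φ '' U ⊆ φ.target := by rintro _ ⟨x, hx, rfl⟩; exact φ.map_source (hUφ hx)
  have hΓk : ContDiffOn ℝ k (D.christoffel φ) (φ '' U) :=
    (D.contDiffOn_christoffel hD hφ).mono hΩt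
  have hΓ : ContDiffOn ℝ 1 (D.christoffel φ) (φ '' U) := hΓk.of_le (by exact_mod_cast hk)
  have hflat : ∀ y ∈ φ '' U, ∀ u v, connectionCurvature (D.christoffel φ) y u v = 0 := by
    rintro _ ⟨x, hx, rfl⟩ u v
    exact h.connectionCurvature_christoffel_eq_zero hφ hx (hUφ hx)
      (hΓ.contDiffAt (hΩ.mem_nhds (mem_image_of_mem φ hx))) u v
  choose s hs0 hs using fun i : Fin n ↦ exists_isParallelOn_of_flat hΩ hconv hΓ hflat
    (mem_image_of_mem φ hp) (EuclideanSpace.single i (1 : ℝ))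
  have hli : ∀ y ∈ φ '' U, LinearIndependent ℝ fun i ↦ s i y := fun y hy ↦ by
    rw [Fintype.linearIndependent_iff]
    intro c hc
    -- A linear relation between the `s i` at `y` is a zero of a parallel section, which therefore
    -- vanishes at `φ p` as well.
    have hsum : IsParallelOn (D.christoffel φ) (fun y ↦ ∑ i, c i • s i y) (φ '' U) := fun z hz ↦ by
      refine (HasFDerivAt.fun_sum fun i _ ↦ (hs i z hz).const_smul (c i)).congr_fderiv ?_
      ext1 v
      simp
    have h0 := hsum.eq_zero_of_eq_zero hconv hΓ.continuousOn hy (mem_image_of_mem φ hp) hc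
    simp only [hs0] at h0
    have hc0 : WithLp.toLp 2 c = 0 := (EuclideanSpace.sum_smul_single _).symm.trans h0
    exact fun i ↦ by simpa using congrArg (· i) hc0
  have hbasis : ∀ x ∈ U, ∃ b : Module.Basis (Fin n) ℝ (TangentSpace (𝓡 n) x),
      (b : Fin n → TangentSpace (𝓡 n) x) = fun i ↦ chartField φ (s i) x := fun x hx ↦ by
    obtain ⟨e, he⟩ := exists_chartFieldAt_eq hφ (hUφ hx)
    refine ⟨(basisOfLinearIndependentOfCardEqFinrank' _ (hli _ (mem_image_of_mem φ hx))
      (by simp)).map e.toLinearEquiv, ?_⟩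
    funext i
    simp [chartField_apply, he]
  have hframe : IsLocalFrameOn (𝓡 n) (EuclideanSpace ℝ (Fin n)) m (fun i ↦ chartField φ (s i)) U :=
    { linearIndependent := fun {x} hx ↦ by
        obtain ⟨b, hb⟩ := hbasis x hx
        exact hb ▸ b.linearIndependent
      generating := fun {x} hx ↦ by
        obtain ⟨b, hb⟩ := hbasis x hx
        exact hb ▸ b.span_eq.ge
      contMDiffOn := fun i x hx ↦ (contMDiffAt_chartField hφ (hUφ hx)
        (((hs i).contDiffOn hΩ hΓk).of_le (by exact_mod_cast hmk) |>.contDiffAt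
          (hΩ.mem_nhds (mem_image_of_mem φ hx)))).contMDiffWithinAt }
  refine ⟨_, hframe, fun i j l x hx ↦ ?_⟩
  have hpx := hs j _ (mem_image_of_mem φ hx)
  have h0 : D (chartField φ (s j)) x (chartField φ (s l) x) = 0 := by
    rw [chartField_apply, D.apply_chartField hφ (hUφ hx) hpx.differentiableAt, hpx.fderiv]
    simp
  unfold components
  rw [h0, map_zero]

end LinearConnection

omit [T2Space M] in
theorem exists_isCoordinateConvex_subset {U : Set M} (hU : IsOpen U) {p : M} (hp : p ∈ U) :
    ∃ V : Set M, IsOpen V ∧ p ∈ V ∧ V ⊆ U ∧ IsCoordinateConvex n V := by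
  set φ := chartAt (EuclideanSpace ℝ (Fin n)) p
  have hps : p ∈ φ.source := mem_chart_source _ p
  have hopen : IsOpen (φ '' (U ∩ φ.source)) :=
    φ.isOpen_image_of_subset_source (hU.inter φ.open_source) inter_subset_right
  obtain ⟨r, hr, hball⟩ := Metric.isOpen_iff.1 hopen (φ p) (mem_image_of_mem φ ⟨hp, hps⟩)
  have hbt : ball (φ p) r ⊆ φ.target := fun y hy ↦ by
    obtain ⟨x, hx, rfl⟩ := hball hy
    exact φ.map_source hx.2
  have himg : φ.symm '' ball (φ p) r ⊆ U ∩ φ.source := by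
    rintro _ ⟨y, hy, rfl⟩
    obtain ⟨x, hx, rfl⟩ := hball hy
    rwa [φ.left_inv hx.2]
  refine ⟨φ.symm '' ball (φ p) r, φ.symm.isOpen_image_of_subset_source isOpen_ball hbt,
    ⟨φ p, mem_ball_self hr, φ.left_inv hps⟩, himg.trans inter_subset_left, φ,
    IsManifold.chart_mem_maximalAtlas p, himg.trans inter_subset_right, ?_⟩
  rw [image_image, (image_congr fun y hy ↦ φ.right_inv (hbt hy) :
    (fun y ↦ φ (φ.symm y)) '' ball (φ p) r = (fun y ↦ y) '' ball (φ p) r), image_id']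
  exact convex_ball _ _
end

end

theorem corollary5 {n : ℕ} {M : Type*} [TopologicalSpace M] [T2Space M]
    [ChartedSpace (EuclideanSpace ℝ (Fin n)) M] [IsManifold (𝓡 n) ∞ M]
    (D : LinearConnection n M) (k m : ℕ∞) (hk : 1 ≤ k)
    (hD : CovariantDerivative.ContMDiffCovariantDerivative D (k : WithTop ℕ∞))
    (hm : 1 ≤ m) (hmk : m ≤ k + 1) (U : Set M) (hU : IsOpen U) :
    (D.IsFlatOn U ↔
      ∀ p ∈ U, ∃ V : Set M, IsOpen V ∧ p ∈ V ∧ V ⊆ U ∧ D.HasVanishingComponentsBasis m V) ∧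
    (IsCoordinateConvex n U →
      (D.HasVanishingComponentsBasis m U ↔ D.IsFlatOn U)) := by
  refine ⟨⟨fun h p hp ↦ ?_, fun h X Y Z hX hY hZ x hx ↦ ?_⟩, fun hconv ↦
    ⟨fun h ↦ h.isFlatOn hk hD hm hU, fun h ↦ h.hasVanishingComponentsBasis hk hD hmk hU hconv⟩⟩
  · obtain ⟨V, hV, hpV, hVU, hVconv⟩ := exists_isCoordinateConvex_subset (n := n) hU hp
    have hflat : D.IsFlatOn V := fun X Y Z hX hY hZ x hx ↦ h X Y Z hX hY hZ x (hVU hx)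
    exact ⟨V, hV, hpV, hVU, hflat.hasVanishingComponentsBasis hk hD hmk hV hVconv⟩
  · obtain ⟨V, hV, hxV, -, hB⟩ := h x hx
    exact hB.isFlatOn hk hD hm hV X Y Z hX hY hZ x hxV
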